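/- Let $X$ be a real Hausdorff locally convex space with topological dual $X^*$, and let $\mathrm{cl}$ denote closure in $X^*$ for the weak-star topology $w(X^*,X)$. For $f:X\to[-\infty,\infty]$ put $f^*(x^*)=\sup_{x\in X}\{\langle x^*,x\rangle-f(x)\}$ for $x^*\in X^*$ and $f^{**}(x)=\sup_{x^*\in X^*}\{\langle x^*,x\rangle-f^*(x^*)\}$ for $x\in X$. A $[-\infty,\infty]$-valued function is proper if it never equals $-\infty$ and is not identically $+\infty$; its domain is the set where it is $<+\infty$. The function $f$ is epi-pointed if $f^*$ is proper and is continuous at some point of its domain for the Mackey topology $\tau(X^*,X)$; $\Gamma_0(X)$ is the set of proper lower semicontinuous convex functions on $X$. For $\varepsilon\ge 0$ put $$\partial_\varepsilon f(x)=\{x^*\in X^*:\langle x^*,y-x\rangle\le f(y)-f(x)+\varepsilon\ \text{ for all } y\in X\}$$ if $f(x)\in\mathbb{R}$, and $\partial_\varepsilon f(x)=\emptyset$ otherwise. **Theorem.** Let $(T,\preceq)$ be a nonempty directed set and let $\{f_t\}_{t\in T}$ be a family of functions $X\to[-\infty,\infty]$ that is increasing, i.e. $f_t\le f_s$ pointwise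 whenever $t\preceq s$. Assume that all the $f_t$ are epi-pointed, or that all the $f_t$ belong to $\Gamma_0(X)$. Let $f=\sup_{t\in T}f_t$ (pointwise), and suppose that $f$ is not identically $+\infty$ and that $f^{**}=\sup_{t\in T}f_t^{**}$. Then for all $\varepsilon\ge 0$ and all $x\in X$, $$\partial_\varepsilon f(x)=\bigcap_{t\in T,\ \gamma>0}\mathrm{cl}\Big(\bigcup_{s\succeq t}\partial_{\varepsilon+\gamma}f_s(x)\Big)=\bigcap_{t\in T,\ \gamma>0}\mathrm{cl}\Big(\bigcup_{s_0\succeq t}\ \bigcap_{s\succeq s_0}\partial_{\varepsilon+\gamma}f_s(x)\Big).$$ -/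

import Mathlib

open Set Topology

/-- The Fenchel conjugate `f*(x*) = sup_x (⟨x*, x⟩ - f x)` of `f : X → [-∞, ∞]`, a function on the
topological dual `X*` (which `WeakDual ℝ X` endows with the weak-star topology `w(X*, X)`). -/
noncomputable def fenchelConj {X : Type*} [AddCommGroup X] [Module ℝ X] [TopologicalSpace X]
    (f : X → EReal) (p : WeakDual ℝ X) : EReal :=
  ⨆ x : X, (((p x : ℝ) : EReal) - f x)

/-- The biconjugate `f**(x) = sup_{x*} (⟨x*, x⟩ - f*(x*))`, a function on `X`. -/
noncomputable def fenchelBiconj {X : Type*} [AddCommGroup X] [Module ℝ X] [TopologicalSpace X]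
    (f : X → EReal) (x : X) : EReal :=
  ⨆ p : WeakDual ℝ X, (((p x : ℝ) : EReal) - fenchelConj f p)

/-- A function with values in `[-∞, ∞]` is proper if its domain `{f < +∞}` is nonempty and it never
takes the value `-∞`. -/
def ProperFun {E : Type*} (f : E → EReal) : Prop :=
  (∃ x, f x < ⊤) ∧ ∀ x, ⊥ < f x

/-- The family of all convex, balanced, weakly compact subsets of `X`. -/
def mackeyFamily (X : Type*) [AddCommGroup X] [Module ℝ X] [TopologicalSpace X] : Set (Set X) :=
  {K | Convex ℝ K ∧ Balanced ℝ K ∧ IsCompact (toWeakSpace ℝ X '' K)}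

/-- The Mackey topology `τ(X*, X)` on the dual: uniform convergence on the convex, balanced, weakly
compact subsets of `X`. -/
@[reducible]
noncomputable def mackeyTopology (X : Type*) [AddCommGroup X] [Module ℝ X] [TopologicalSpace X] :
    TopologicalSpace (WeakDual ℝ X) :=
  TopologicalSpace.induced
    (fun p : WeakDual ℝ X => UniformOnFun.ofFun (mackeyFamily X) (fun x => p x))
    (UniformOnFun.topologicalSpace X ℝ (mackeyFamily X))

/-- `f` is epi-pointed if `f*` is proper and `τ(X*, X)`-continuous at some point of its domain. -/
def EpiPointed {X : Type*} [AddCommGroup X] [Module ℝ X] [TopologicalSpace X]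
    (f : X → EReal) : Prop :=
  ProperFun (fenchelConj f) ∧
    ∃ p : WeakDual ℝ X, fenchelConj f p < ⊤ ∧
      @ContinuousAt (WeakDual ℝ X) EReal (mackeyTopology X) _ (fenchelConj f) p

/-- The class `Γ₀(X)` of proper lower semicontinuous convex functions; convexity is that of the
epigraph. -/
def GammaZero (X : Type*) [AddCommGroup X] [Module ℝ X] [TopologicalSpace X] :
    Set (X → EReal) :=
  {f | ProperFun f ∧ LowerSemicontinuous f ∧ Convex ℝ {q : X × ℝ | f q.1 ≤ (q.2 : EReal)}}

/-- The `ε`-subdifferential `∂_ε f(x)`; it is empty where `f` is not finite. -/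
def epsSubdiff {X : Type*} [AddCommGroup X] [Module ℝ X] [TopologicalSpace X]
    (f : X → EReal) (ε : ℝ) (x : X) : Set (WeakDual ℝ X) :=
  {p | f x ≠ ⊤ ∧ f x ≠ ⊥ ∧ ∀ y : X, ((p (y - x) : ℝ) : EReal) ≤ f y - f x + (ε : EReal)}

/-!
The epigraph of the conjugate `f*` is the set of *affine minorants* of `f`, the pairs `(q, r)` with
`⟨q, y⟩ - r ≤ f y` for all `y`, and `p ∈ ∂_ε f(x)` means that `f x` is finite and that
`(p, ⟨p, x⟩ - f x + ε)` is such a pair (`mem_epsSubdiff_iff`).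

For an increasing family the affine minorants of the members form a directed union of convex sets,
hence a convex set `C`. The key fact is that every affine minorant of `F = sup_t f_t` lies in the
closure of `C` in `X* × ℝ`, for the weak-star topology on `X*` (`mem_closure_iUnion_affineMinorants`).
Otherwise Hahn–Banach separates it from `C` by a functional `(q, r) ↦ ⟨q, z⟩ + α r` with `z ∈ X` and
`α ≤ 0`. If `α < 0`, then after rescaling this contradicts `F** ≤ sup_t f_t**` at `z`; if `α = 0`, it
contradicts this inequality at `x + λ z` for large `λ`.

Consequently, near any `p ∈ ∂_ε F(x)` there is an affine minorant `(q, r)` of some `f_s` with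
`r < ⟨q, x⟩ - F x + ε + γ`. It is still a minorant of all later members of the family, and they are at
most `F x` at `x`, so `q` is an `(ε + γ)`-subgradient of all of them. The opposite inclusion passes to
the limit in the subgradient inequalities, after replacing `f_s y` by the larger `F y` and `f_s x` by
the smaller `f_t x` for a fixed `t` (`iSup_le_of_mem_closure`).
-/

/-! ### Affine minorants, conjugates and subdifferentials -/

section AffineMinorants

variable {X : Type*} [AddCommGroup X] [Module ℝ X] [TopologicalSpace X]

/-- The pairs `(q, r)` for which the continuous affine function `y ↦ ⟨q, y⟩ - r` is a minorant
of `f`; this is the epigraph of the Fenchel conjugate of `f`. -/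
def affineMinorants (f : X → EReal) : Set (WeakDual ℝ X × ℝ) :=
  {c | ∀ y, ((c.1 y - c.2 : ℝ) : EReal) ≤ f y}

theorem fenchelConj_le_coe_iff (f : X → EReal) (q : WeakDual ℝ X) (r : ℝ) :
    fenchelConj f q ≤ r ↔ (q, r) ∈ affineMinorants f := by
  simp only [fenchelConj, iSup_le_iff, affineMinorants, Set.mem_ofPred_eq]
  refine forall_congr' fun y => ?_
  induction f y using EReal.rec with
  | bot =>
    simp only [EReal.coe_sub_bot, top_le_iff, EReal.coe_ne_top, le_bot_iff, EReal.coe_ne_bot]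
  | coe a => norm_cast; constructor <;> intro h <;> linarith
  | top => simp

/-- The biconjugate is the supremum of the continuous affine minorants. -/
theorem fenchelBiconj_le_coe_iff (f : X → EReal) (z : X) (M : ℝ) :
    fenchelBiconj f z ≤ M ↔ ∀ c ∈ affineMinorants f, c.1 z - c.2 ≤ M := by
  simp only [fenchelBiconj, iSup_le_iff, Prod.forall, ← fenchelConj_le_coe_iff]
  refine forall_congr' fun q => ?_
  induction fenchelConj f q using EReal.rec with
  | bot =>
    -- Both sides fail: arbitrarily small constants `r` are admissible.
    simp only [EReal.coe_sub_bot, top_le_iff, EReal.coe_ne_top, bot_le, forall_const, false_iff,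
      not_forall, not_le]
    exact ⟨q z - M - 1, by linarith⟩
  | coe a =>
    norm_cast
    exact ⟨fun h r hr => by linarith, fun h => h a le_rfl⟩
  | top => simp

theorem affineMinorants_mono {f g : X → EReal} (h : f ≤ g) :
    affineMinorants f ⊆ affineMinorants g :=
  fun _ hc y => (hc y).trans (h y)

theorem mem_affineMinorants_of_le {f : X → EReal} {q : WeakDual ℝ X} {r r' : ℝ}
    (h : (q, r) ∈ affineMinorants f) (hr : r ≤ r') : (q, r') ∈ affineMinorants f :=
  fun y => (EReal.coe_le_coe_iff.2 (by dsimp only; linarith)).trans (h y)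

theorem convex_affineMinorants (f : X → EReal) : Convex ℝ (affineMinorants f) := by
  intro c hc d hd a b ha hb hab y
  have hmax : ((max (c.1 y - c.2) (d.1 y - d.2) : ℝ) : EReal) ≤ f y := by
    rcases max_choice (c.1 y - c.2) (d.1 y - d.2) with h | h <;> rw [h]
    exacts [hc y, hd y]
  refine (EReal.coe_le_coe_iff.2 ?_).trans hmax
  have h := Convex.combo_le_max (c.1 y - c.2) (d.1 y - d.2) ha hb hab
  simp only [smul_eq_mul] at h
  have e : (a • c + b • d).1 y - (a • c + b • d).2
      = a * (c.1 y - c.2) + b * (d.1 y - d.2) := by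
    change (a * c.1 y + b * d.1 y) - (a * c.2 + b * d.2) = _
    ring
  rw [e]
  exact h

theorem mem_epsSubdiff_iff {f : X → EReal} {ε : ℝ} {x : X} {p : WeakDual ℝ X} :
    p ∈ epsSubdiff f ε x ↔ ∃ a : ℝ, f x = a ∧ (p, p x - a + ε) ∈ affineMinorants f := by
  simp only [epsSubdiff, Set.mem_ofPred_eq, affineMinorants]
  constructor
  · rintro ⟨htop, hbot, h⟩
    lift f x to ℝ using ⟨htop, hbot⟩ with a
    refine ⟨a, rfl, fun y => ?_⟩
    have hy := h y
    rw [map_sub] at hy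
    generalize f y = F at hy ⊢
    induction F using EReal.rec with
    | bot =>
      rw [EReal.bot_sub, EReal.bot_add] at hy
      exact absurd (le_bot_iff.1 hy) (EReal.coe_ne_bot _)
    | coe b => norm_cast at hy ⊢; linarith
    | top => simp
  · rintro ⟨a, ha, h⟩
    refine ⟨by simp [ha], by simp [ha], fun y => ?_⟩
    have hy := h y
    rw [map_sub, ha]
    generalize f y = F at hy ⊢
    induction F using EReal.rec with
    | bot => exact absurd (le_bot_iff.1 hy) (EReal.coe_ne_bot _)
    | coe b => norm_cast at hy ⊢; linarith
    | top => simp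

end AffineMinorants

/-! ### The epigraph of the conjugate of a supremum -/

/-- Every continuous linear functional on `X* × ℝ`, with the weak-star topology on `X*`, has the form
`(q, r) ↦ ⟨q, z⟩ + α r` with `z ∈ X`. -/
theorem exists_eval_add_mul_of_continuousLinearMap {X : Type*} [AddCommGroup X] [Module ℝ X]
    [TopologicalSpace X] (φ : WeakDual ℝ X × ℝ →L[ℝ] ℝ) :
    ∃ (z : X) (α : ℝ), ∀ (q : WeakDual ℝ X) (r : ℝ), φ (q, r) = q z + α * r := by
  obtain ⟨z, hz⟩ := LinearMap.dualEmbedding_surjective (topDualPairing ℝ X)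
    (φ.comp (ContinuousLinearMap.inl ℝ (WeakDual ℝ X) ℝ))
  refine ⟨z, φ (0, 1), fun q r => ?_⟩
  have h1 : φ (q, 0) = q z := (DFunLike.congr_fun hz q).symm
  have h2 : ((q, r) : WeakDual ℝ X × ℝ) = (q, 0) + r • ((0, 1) : WeakDual ℝ X × ℝ) := by simp
  rw [h2, map_add, map_smul, h1, smul_eq_mul, mul_comm]

section Family

variable {X : Type*} [AddCommGroup X] [Module ℝ X] [TopologicalSpace X]
  {T : Type*} [Preorder T]

theorem convex_iUnion_affineMinorants [IsDirectedOrder T] {f : T → X → EReal}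
    (hmono : Monotone f) : Convex ℝ (⋃ t, affineMinorants (f t)) :=
  (Monotone.directed_le fun _ _ h => affineMinorants_mono (hmono h)).convex_iUnion
    fun t => convex_affineMinorants (f t)

/-- Epigraphical form of the identity `(sup_t f_t)* = cl (inf_t f_t*)`, a consequence of
`(sup_t f_t)** ≤ sup_t f_t**`. -/
theorem mem_closure_iUnion_affineMinorants [IsDirectedOrder T] {f : T → X → EReal}
    (hmono : Monotone f)
    (hbi : ∀ z, fenchelBiconj (fun y => ⨆ t, f t y) z ≤ ⨆ t, fenchelBiconj (f t) z)
    {x : X} (hx : ⨆ t, f t x ≠ ⊤) {p : WeakDual ℝ X} {r₀ : ℝ}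
    (hp : (p, r₀) ∈ affineMinorants (fun y => ⨆ t, f t y)) :
    (p, r₀) ∈ closure (⋃ t, affineMinorants (f t)) := by
  -- The hypothesis on biconjugates, in terms of affine minorants.
  have key : ∀ (z : X) (M : ℝ),
      (∀ t, ∀ c ∈ affineMinorants (f t), c.1 z - c.2 ≤ M) → p z - r₀ ≤ M := by
    intro z M hM
    have h : fenchelBiconj (fun y => ⨆ t, f t y) z ≤ M :=
      (hbi z).trans (iSup_le fun t => (fenchelBiconj_le_coe_iff _ _ _).2 (hM t))
    exact (fenchelBiconj_le_coe_iff _ _ _).1 h _ hp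
  by_contra hnot
  have hlc : LocallyConvexSpace ℝ (WeakDual ℝ X) :=
    inferInstanceAs (LocallyConvexSpace ℝ (WeakBilin (topDualPairing ℝ X)))
  obtain ⟨φ, u, hu, hpu⟩ := geometric_hahn_banach_closed_point
    (convex_iUnion_affineMinorants hmono).closure isClosed_closure hnot
  obtain ⟨z, α, hφ⟩ := exists_eval_add_mul_of_continuousLinearMap φ
  have hC : ∀ t, ∀ c ∈ affineMinorants (f t), c.1 z + α * c.2 < u := fun t c hc =>
    (hφ c.1 c.2) ▸ hu c (subset_closure (Set.mem_iUnion.2 ⟨t, hc⟩))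
  rw [hφ] at hpu
  rcases lt_trichotomy α 0 with hα | rfl | hα
  · -- A separating hyperplane that is not vertical: normalise its last coefficient to `-1`.
    have h := key ((-α)⁻¹ • z) ((-α)⁻¹ * u) fun t c hc => by
      have h1 := mul_le_mul_of_nonneg_left (hC t c hc).le (inv_nonneg.2 (neg_nonneg.2 hα.le))
      have h2 : (-α)⁻¹ * (c.1 z + α * c.2) = (-α)⁻¹ * c.1 z - c.2 := by
        have h3 : (-α)⁻¹ * α = -1 := by rw [inv_neg, neg_mul, inv_mul_cancel₀ hα.ne]
        linear_combination c.2 * h3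
      rw [map_smul, smul_eq_mul]
      linarith
    have h1 := mul_lt_mul_of_pos_left hpu (inv_pos.2 (neg_pos.2 hα))
    have h2 : (-α)⁻¹ * (p z + α * r₀) = (-α)⁻¹ * p z - r₀ := by
      have h3 : (-α)⁻¹ * α = -1 := by rw [inv_neg, neg_mul, inv_mul_cancel₀ hα.ne]
      linear_combination r₀ * h3
    rw [map_smul, smul_eq_mul] at h
    linarith
  · -- A vertical hyperplane: move from `x` far in the direction `z`.
    have hbot : ⨆ t, f t x ≠ ⊥ := fun hb =>
      EReal.coe_ne_bot _ (le_bot_iff.1 ((hp x).trans hb.le))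
    obtain ⟨a, ha⟩ : ∃ a : ℝ, ⨆ t, f t x = a := by
      lift ⨆ t, f t x to ℝ using ⟨hx, hbot⟩ with a
      exact ⟨a, rfl⟩
    have h : ∀ l : ℝ, 0 ≤ l → p x + l * p z - r₀ ≤ a + l * u := by
      intro l hl
      have h := key (x + l • z) (a + l * u) fun t c hc => by
        have h1 : c.1 x - c.2 ≤ a := EReal.coe_le_coe_iff.1
          (((hc x).trans (le_iSup (fun t => f t x) t)).trans ha.le)
        have h2 := mul_le_mul_of_nonneg_left (hC t c hc).le hl
        rw [map_add, map_smul, smul_eq_mul]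
        linarith
      rwa [map_add, map_smul, smul_eq_mul] at h
    have hd : 0 < p z - u := by linarith
    have hl := h ((|a + r₀ - p x| + 1) / (p z - u)) (by positivity)
    have e : (|a + r₀ - p x| + 1) / (p z - u) * (p z - u) = |a + r₀ - p x| + 1 :=
      div_mul_cancel₀ _ hd.ne'
    have := le_abs_self (a + r₀ - p x)
    linarith
  · -- `α > 0` is impossible, since the constant of a minorant may be increased at will; such a
    -- minorant exists because otherwise `key` would hold for every `M`.
    obtain ⟨t, c, hc⟩ : ∃ t, ∃ c, c ∈ affineMinorants (f t) := by
      by_contra! hne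
      have := key x (p x - r₀ - 1) fun t c hc => absurd hc (hne t c)
      linarith
    have h := hC t (c.1, max c.2 ((u - c.1 z) / α))
      (mem_affineMinorants_of_le hc (le_max_left _ _))
    have h1 := mul_le_mul_of_nonneg_left (le_max_right c.2 ((u - c.1 z) / α)) hα.le
    rw [mul_div_cancel₀ _ hα.ne'] at h1
    dsimp only at h
    linarith

/-! ### Subdifferentials of the supremum -/

/-- The limiting form of the subgradient inequality at a point `y` where `sup_t f_t` is finite. -/
theorem iSup_le_of_mem_closure {f : T → X → EReal} (hmono : Monotone f) {ε : ℝ} {x y : X}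
    {p : WeakDual ℝ X}
    (hp : ∀ (t : T) (γ : ℝ), 0 < γ →
      p ∈ closure (⋃ (s : T) (_ : t ≤ s), epsSubdiff (f s) (ε + γ) x))
    {b : ℝ} (hb : ⨆ t, f t y = b) :
    ⨆ t, f t x ≤ ((b + ε - p (y - x) : ℝ) : EReal) := by
  refine iSup_le fun t => EReal.ge_of_forall_gt_iff_ge.1 fun c hc => EReal.coe_le_coe_iff.2 ?_
  refine le_of_forall_pos_le_add fun γ hγ => ?_
  have hclosed : IsClosed {q : WeakDual ℝ X | q (y - x) ≤ b - c + ε + γ} :=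
    isClosed_le (WeakDual.eval_continuous (y - x)) continuous_const
  have hsub : (⋃ (s : T) (_ : t ≤ s), epsSubdiff (f s) (ε + γ) x) ⊆
      {q : WeakDual ℝ X | q (y - x) ≤ b - c + ε + γ} := by
    intro q hq
    simp only [Set.mem_iUnion] at hq
    obtain ⟨s, hts, hq⟩ := hq
    obtain ⟨a, ha, hq⟩ := mem_epsSubdiff_iff.1 hq
    have hca : c ≤ a := EReal.coe_le_coe_iff.1 ((hc.le.trans (hmono hts x)).trans ha.le)
    have h := EReal.coe_le_coe_iff.1
      (((hq y).trans (le_iSup (fun t => f t y) s)).trans hb.le)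
    dsimp only at h
    rw [Set.mem_ofPred_eq, map_sub]
    linarith
  have h : p (y - x) ≤ b - c + ε + γ := closure_minimal hsub hclosed (hp t γ hγ)
  linarith

theorem iInter_closure_subset_epsSubdiff_iSup [Nonempty T] {f : T → X → EReal}
    (hmono : Monotone f) (hdom : (fun y => ⨆ t, f t y) ≠ fun _ => ⊤) (ε : ℝ) (x : X) :
    (⋂ (t : T) (γ : ℝ) (_ : 0 < γ),
      closure (⋃ (s : T) (_ : t ≤ s), epsSubdiff (f s) (ε + γ) x)) ⊆
      epsSubdiff (fun y => ⨆ t, f t y) ε x := by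
  intro p hp
  simp only [Set.mem_iInter] at hp
  -- Some member of the family is subdifferentiable, so `sup_t f_t` never takes the value `-∞`.
  have hbot : ∀ y, ⨆ t, f t y ≠ ⊥ := by
    intro y hy
    obtain ⟨q, hq⟩ := closure_nonempty_iff.1 ⟨p, hp (Classical.arbitrary T) 1 one_pos⟩
    simp only [Set.mem_iUnion] at hq
    obtain ⟨s, -, hq⟩ := hq
    obtain ⟨a, -, hq⟩ := mem_epsSubdiff_iff.1 hq
    exact EReal.coe_ne_bot _
      (le_bot_iff.1 (((hq y).trans (le_iSup (fun t => f t y) s)).trans hy.le))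
  have hreal : ∀ y, ⨆ t, f t y ≠ ⊤ → ∃ b : ℝ, ⨆ t, f t y = b := by
    intro y hy
    have hy' := hbot y
    lift ⨆ t, f t y to ℝ using ⟨hy, hy'⟩ with b
    exact ⟨b, rfl⟩
  obtain ⟨y₀, hy₀⟩ := Function.ne_iff.1 hdom
  obtain ⟨b₀, hb₀⟩ := hreal y₀ hy₀
  obtain ⟨a, ha⟩ := hreal x
    ((iSup_le_of_mem_closure hmono hp hb₀).trans_lt (EReal.coe_lt_top _)).ne
  refine mem_epsSubdiff_iff.2 ⟨a, ha, fun y => ?_⟩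
  by_cases hy : ⨆ t, f t y = ⊤
  · simp only [hy, le_top]
  · obtain ⟨b, hb⟩ := hreal y hy
    have h := EReal.coe_le_coe_iff.1 (ha ▸ iSup_le_of_mem_closure hmono hp hb)
    rw [map_sub] at h
    simp only [hb]
    exact EReal.coe_le_coe_iff.2 (by linarith)

theorem epsSubdiff_iSup_subset_closure [IsDirectedOrder T] {f : T → X → EReal}
    (hmono : Monotone f)
    (hbi : ∀ z, fenchelBiconj (fun y => ⨆ t, f t y) z ≤ ⨆ t, fenchelBiconj (f t) z)
    (ε : ℝ) (x : X) (t : T) {γ : ℝ} (hγ : 0 < γ) :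
    epsSubdiff (fun y => ⨆ t, f t y) ε x ⊆
      closure (⋃ (s₀ : T) (_ : t ≤ s₀), ⋂ (s : T) (_ : s₀ ≤ s), epsSubdiff (f s) (ε + γ) x) := by
  intro p hp
  obtain ⟨a, ha, hp⟩ := mem_epsSubdiff_iff.1 hp
  have hcl := mem_closure_iUnion_affineMinorants hmono hbi (x := x) (by simp [ha]) hp
  refine mem_closure_iff.2 fun U hU hpU => ?_
  have hV : IsOpen {c : WeakDual ℝ X × ℝ | c.1 ∈ U ∧ c.2 < c.1 x - a + (ε + γ)} := by
    refine (hU.preimage continuous_fst).inter (isOpen_lt continuous_snd ?_)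
    have := (WeakDual.eval_continuous (𝕜 := ℝ) x).comp
      (continuous_fst : Continuous (Prod.fst : WeakDual ℝ X × ℝ → WeakDual ℝ X))
    exact (this.sub continuous_const).add continuous_const
  obtain ⟨⟨q, r⟩, ⟨hqU, hr⟩, hq⟩ :=
    mem_closure_iff.1 hcl _ hV ⟨hpU, by dsimp only; linarith⟩
  obtain ⟨t', hq⟩ := Set.mem_iUnion.1 hq
  obtain ⟨s₀, hts, hts'⟩ := exists_ge_ge t t'
  refine ⟨q, hqU, ?_⟩
  simp only [Set.mem_iUnion, Set.mem_iInter]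
  refine ⟨s₀, hts, fun s hs => ?_⟩
  have hqs : (q, r) ∈ affineMinorants (f s) :=
    affineMinorants_mono (hmono (hts'.trans hs)) hq
  have hle : f s x ≤ a := (le_iSup (fun t => f t x) s).trans ha.le
  have hge := hqs x
  obtain ⟨a', ha'⟩ : ∃ a' : ℝ, f s x = a' := by
    generalize f s x = F at hle hge ⊢
    induction F using EReal.rec with
    | bot => exact absurd (le_bot_iff.1 hge) (EReal.coe_ne_bot _)
    | coe a' => exact ⟨a', rfl⟩
    | top => exact absurd (top_le_iff.1 hle) (EReal.coe_ne_top _)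
  refine mem_epsSubdiff_iff.2 ⟨a', ha', mem_affineMinorants_of_le hqs ?_⟩
  have : a' ≤ a := EReal.coe_le_coe_iff.1 (ha' ▸ hle)
  dsimp only at hr
  linarith

end Family

theorem mainTheorem6 {X : Type*} [AddCommGroup X] [Module ℝ X] [TopologicalSpace X]
    [IsTopologicalAddGroup X] [ContinuousSMul ℝ X] [LocallyConvexSpace ℝ X] [T2Space X]
    {T : Type*} [Preorder T] [IsDirectedOrder T] [Nonempty T]
    (f : T → X → EReal) (hmono : Monotone f)
    (hfam : (∀ t, EpiPointed (f t)) ∨ (∀ t, f t ∈ GammaZero X))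
    (hbi : ∀ x, fenchelBiconj (fun y => ⨆ t, f t y) x = ⨆ t, fenchelBiconj (f t) x)
    (hdom : (fun y => ⨆ t, f t y) ≠ fun _ => ⊤)
    (ε : ℝ) (hε : 0 ≤ ε) (x : X) :
    epsSubdiff (fun y => ⨆ t, f t y) ε x =
        ⋂ (t : T) (γ : ℝ) (_ : 0 < γ),
          closure (⋃ (s : T) (_ : t ≤ s), epsSubdiff (f s) (ε + γ) x) ∧
    epsSubdiff (fun y => ⨆ t, f t y) ε x =
        ⋂ (t : T) (γ : ℝ) (_ : 0 < γ),
          closure (⋃ (s₀ : T) (_ : t ≤ s₀), ⋂ (s : T) (_ : s₀ ≤ s),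
            epsSubdiff (f s) (ε + γ) x) := by
  have h13 : epsSubdiff (fun y => ⨆ t, f t y) ε x ⊆
      ⋂ (t : T) (γ : ℝ) (_ : 0 < γ),
        closure (⋃ (s₀ : T) (_ : t ≤ s₀), ⋂ (s : T) (_ : s₀ ≤ s),
          epsSubdiff (f s) (ε + γ) x) :=
    Set.subset_iInter fun t => Set.subset_iInter fun γ => Set.subset_iInter fun hγ =>
      epsSubdiff_iSup_subset_closure hmono (fun z => (hbi z).le) ε x t hγ
  have h32 : (⋂ (t : T) (γ : ℝ) (_ : 0 < γ),
        closure (⋃ (s₀ : T) (_ : t ≤ s₀), ⋂ (s : T) (_ : s₀ ≤ s),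
          epsSubdiff (f s) (ε + γ) x)) ⊆
      ⋂ (t : T) (γ : ℝ) (_ : 0 < γ),
        closure (⋃ (s : T) (_ : t ≤ s), epsSubdiff (f s) (ε + γ) x) :=
    Set.iInter_mono fun t => Set.iInter_mono fun γ => Set.iInter_mono fun _ =>
      closure_mono <| Set.iUnion_mono fun s => Set.iUnion_mono fun _ =>
        Set.iInter₂_subset s le_rfl
  have h21 := iInter_closure_subset_epsSubdiff_iSup hmono hdom ε x
  exact ⟨(h13.trans h32).antisymm h21, h13.antisymm (h32.trans h21)⟩
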